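/- A quantum dynamical semigroup (QDS) on $M_N(\mathbb C)$ is a family $(T_t)_{t\ge 0}$ of linear operators on $M_N(\mathbb C)$ such that $T_0=\mathrm{id}$, $T_{t+s}=T_tT_s$, $t\mapsto T_t(A)$ is continuous for every $A$, $\operatorname{Tr}(T_t(A))=\operatorname{Tr}(A)$ for all $t$ and $A$, and every $T_t$ is completely positive; its generator is $\mathcal L(A)=\lim_{t\downarrow 0}\frac1t(T_t(A)-A)$. By the Gorini–Kossakowski–Sudarshan–Lindblad theorem, every QDS generator $\mathcal L$ can be written in exactly one way as $$\mathcal L(\rho)=-i[H,\rho]+\frac12\sum_{i,j,k,\ell=1}^N\gamma_{ijk\ell}\left([E_{ij},\rho E_{k\ell}^*]+[E_{ij}\rho,E_{k\ell}^*]\right),$$ where $E_{ij}$ are the standard matrix units, $H$ (the Hamiltonian of $\mathcal L$) is Hermitian with $\operatorname{Tr}(H)=0$, and $\Gamma=(\gamma_{ijk\ell})$, an $N^2\times N^2$ matrix with rows $(i,j)$ and columns $(k,\ell)$ regarded as an operator on $M_N(\mathbb C)$ with basis $\{E_{ij}\}$, satisfies $\Gamma\ge 0$, $\Gamma(I_N)=0$,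 and $\operatorname{Tr}(\Gamma(A))=0$ for all $A$. Let $G_{\mathcal L}$ be the digraph on $\{1,\dots,N\}$ with an edge from $j$ to $i$ ($i\neq j$) of weight $\gamma_{ij}:=\gamma_{ijij}$ whenever $\gamma_{ij}>0$, let $H_{\mathcal L}$ be the undirected graph obtained from $G_{\mathcal L}$ by ignoring weights and directions, and for each connected component $H_{\mathcal L}^k$ of $H_{\mathcal L}$ let $P_k=\sum_{i\in V(H_{\mathcal L}^k)}E_{ii}$. **Theorem.** Let $\mathcal L$ be a QDS generator on $M_N(\mathbb C)$ with Hamiltonian $H$, and fix a connected component $H_{\mathcal L}^k$ of $H_{\mathcal L}$. If $P_kHP_\ell=0$ for all $\ell\neq k$, then $\operatorname{Tr}(P_k\mathcal L(A))=0$ for all $A\in M_N(\mathbb C)$. -/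

import Mathlib

open scoped Matrix NNReal Topology ComplexOrder

namespace QDS

/-- `M_N(ℂ)`. -/
abbrev Mat (N : ℕ) : Type := Matrix (Fin N) (Fin N) ℂ

/-- Complete positivity of a linear map `φ` on `M_N(ℂ)`: for every `k`, applying `φ` to each of the
`N × N` blocks of a positive semidefinite `k × k` block matrix gives a positive semidefinite
matrix. `Matrix.comp` reads a `k × k` matrix of `N × N` blocks as a `kN × kN` complex matrix. -/
def IsCompletelyPositive {N : ℕ} (φ : Mat N →ₗ[ℂ] Mat N) : Prop :=
  ∀ (k : ℕ) (M : Matrix (Fin k) (Fin k) (Mat N)),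
    (Matrix.comp (Fin k) (Fin k) (Fin N) (Fin N) ℂ M).PosSemidef →
      (Matrix.comp (Fin k) (Fin k) (Fin N) (Fin N) ℂ (M.map φ)).PosSemidef

/-- A quantum dynamical semigroup (Schrödinger picture) on `M_N(ℂ)`. -/
structure IsQDS {N : ℕ} (T : ℝ≥0 → (Mat N →ₗ[ℂ] Mat N)) : Prop where
  zero : T 0 = LinearMap.id
  add : ∀ t s : ℝ≥0, T (t + s) = T t ∘ₗ T s
  continuous : ∀ A : Mat N, Continuous fun t : ℝ≥0 => T t A
  trace : ∀ (t : ℝ≥0) (A : Mat N), (T t A).trace = A.trace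
  completelyPositive : ∀ t : ℝ≥0, IsCompletelyPositive (T t)

/-- `L` is the generator of a QDS: `L A = lim_{t ↓ 0} (T_t A - A) / t` for every `A`. -/
def IsQDSGenerator {N : ℕ} (L : Mat N →ₗ[ℂ] Mat N) : Prop :=
  ∃ T : ℝ≥0 → (Mat N →ₗ[ℂ] Mat N), IsQDS T ∧
    ∀ A : Mat N,
      Filter.Tendsto (fun t : ℝ≥0 => ((t : ℝ)⁻¹ : ℂ) • (T t A - A)) (𝓝[>] 0) (𝓝 (L A))

/-- The standard basis element `E_{ij}` of `M_N(ℂ)`. -/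
abbrev stdE {N : ℕ} (i j : Fin N) : Mat N := Matrix.single i j 1

/-- A coefficient matrix `Γ = (γ_{ijkl})`, with rows `(i, j)` and columns `(k, l)`, regarded as an
operator on `M_N(ℂ)` with basis `E_{ij}`: `Γ(A) = ∑_{ij} (∑_{kl} γ_{ijkl} A_{kl}) E_{ij}`. -/
def coeffOperator {N : ℕ} (Γ : Matrix (Fin N × Fin N) (Fin N × Fin N) ℂ) (A : Mat N) : Mat N :=
  ∑ i, ∑ j, (∑ k, ∑ l, Γ (i, j) (k, l) * A k l) • stdE i j

/-- `L` is written in canonical GKSL form with respect to the standard basis, with Hamiltonian `H`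
and coefficient matrix `Γ = (γ_{ijkl})`:
`L(ρ) = -i[H, ρ] + (1/2) ∑ γ_{ijkl} ([E_{ij}, ρ E_{kl}^*] + [E_{ij} ρ, E_{kl}^*])`,
where `H` is Hermitian and traceless, `Γ ≥ 0`, `Γ(I) = 0` and `Tr(Γ(A)) = 0` for all `A`. -/
structure IsCanonicalForm {N : ℕ} (L : Mat N →ₗ[ℂ] Mat N) (H : Mat N)
    (Γ : Matrix (Fin N × Fin N) (Fin N × Fin N) ℂ) : Prop where
  hermitian : H.IsHermitian
  traceless : H.trace = 0
  posSemidef : Γ.PosSemidef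
  map_one : coeffOperator Γ 1 = 0
  trace_map : ∀ A : Mat N, (coeffOperator Γ A).trace = 0
  form : ∀ ρ : Mat N,
    L ρ = -Complex.I • ⁅H, ρ⁆ +
      (1 / 2 : ℂ) • ∑ i, ∑ j, ∑ k, ∑ l,
        Γ (i, j) (k, l) • (⁅stdE i j, ρ * (stdE k l)ᴴ⁆ + ⁅stdE i j * ρ, (stdE k l)ᴴ⁆)

/-- The pair `(H, Γ)` of the canonical GKSL form of `L`. For a QDS generator `L` this pair exists
and is unique by the Gorini-Kossakowski-Sudarshan-Lindblad theorem; for other `L` the value is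
irrelevant. -/
noncomputable def canonicalPair {N : ℕ} (L : Mat N →ₗ[ℂ] Mat N) :
    Mat N × Matrix (Fin N × Fin N) (Fin N × Fin N) ℂ :=
  Classical.epsilon fun p => IsCanonicalForm L p.1 p.2

/-- The Hamiltonian `H` of a QDS generator. -/
noncomputable def hamiltonian {N : ℕ} (L : Mat N →ₗ[ℂ] Mat N) : Mat N :=
  (canonicalPair L).1

/-- The coefficient matrix `Γ` of a QDS generator with respect to the standard basis. -/
noncomputable def coeffMatrix {N : ℕ} (L : Mat N →ₗ[ℂ] Mat N) :
    Matrix (Fin N × Fin N) (Fin N × Fin N) ℂ :=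
  (canonicalPair L).2

/-- The weight `γ_{ij} = γ_{ijij}`; it is a nonnegative real number since `Γ ≥ 0`. -/
noncomputable def weight {N : ℕ} (L : Mat N →ₗ[ℂ] Mat N) (i j : Fin N) : ℝ :=
  (coeffMatrix L (i, j) (i, j)).re

/-- The digraph `G_L` (without its weights): there is an edge from `j` to `i` (with `i ≠ j`) when
its weight `γ_{ij}` is positive. -/
def inducedDigraph {N : ℕ} (L : Mat N →ₗ[ℂ] Mat N) : Digraph (Fin N) where
  Adj j i := i ≠ j ∧ 0 < weight L i j

/-- The graph `H_L`, obtained from `G_L` by ignoring weights and directedness of the edges. -/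
def inducedGraph {N : ℕ} (L : Mat N →ₗ[ℂ] Mat N) : SimpleGraph (Fin N) :=
  (inducedDigraph L).toSimpleGraphInclusive

open Classical in
/-- The projection `∑_{i ∈ V(c)} E_{ii}` onto the block of the vertices of a connected component
`c` of a graph on `N` vertices. -/
noncomputable def blockProj {N : ℕ} {G : SimpleGraph (Fin N)} (c : G.ConnectedComponent) : Mat N :=
  ∑ i : Fin N, if i ∈ c.supp then stdE i i else 0

end QDS

namespace QDS

open Matrix Filter

variable {N : ℕ}

/-! With `p` the indicator of the component, the dissipative part of `Tr (P_k L(A))` is the sum of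
`(p i - (p j + p l) / 2) γ_{ijil} A j l` (`trace_diagonal_mul_dissipator`). Since `Γ ≥ 0`, a nonzero
`γ_{ijil}` forces `γ_{ij}` and `γ_{il}` to be positive, so `i`, `j`, `l` share a component and the
coefficient vanishes. The Hamiltonian part vanishes by cyclicity of the trace, because `P_k`
commutes with `H`. As `H` and `Γ` are chosen by `Classical.epsilon`, the canonical form must be
shown to exist (`exists_isCanonicalForm`); uniqueness is not needed. `Γ` is the Choi matrix of `L`
compressed to the traceless matrices, and the remainder has the form `K ρ + ρ Kᴴ`. -/

/-- The map `ρ ↦ ∑ γ_{ijkl} E_{ij} ρ E_{kl}^*`. -/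
def krausMap (Γ : Matrix (Fin N × Fin N) (Fin N × Fin N) ℂ) (ρ : Mat N) : Mat N :=
  ∑ i, ∑ j, ∑ k, ∑ l, Γ (i, j) (k, l) • (stdE i j * ρ * (stdE k l)ᴴ)

/-- The matrix `∑ γ_{ijkl} E_{kl}^* E_{ij}`. -/
def krausDualOne (Γ : Matrix (Fin N × Fin N) (Fin N × Fin N) ℂ) : Mat N :=
  ∑ i, ∑ j, ∑ k, ∑ l, Γ (i, j) (k, l) • ((stdE k l)ᴴ * stdE i j)

theorem krausMap_apply (Γ : Matrix (Fin N × Fin N) (Fin N × Fin N) ℂ) (ρ : Mat N) (a b : Fin N) :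
    krausMap Γ ρ a b = ∑ j, ∑ l, Γ (a, j) (b, l) * ρ j l := by
  simp only [krausMap, Matrix.sum_apply, Matrix.smul_apply, conjTranspose_single, star_one,
    single_mul_mul_single, one_mul, mul_one]
  rw [Finset.sum_eq_single a (by
    intro i _ hi
    simp [hi]) (by simp)]
  refine Finset.sum_congr rfl fun j _ => ?_
  rw [Finset.sum_eq_single b (by
    intro i _ hi
    simp [hi]) (by simp)]
  simp

theorem krausDualOne_apply (Γ : Matrix (Fin N × Fin N) (Fin N × Fin N) ℂ) (a b : Fin N) :
    krausDualOne Γ a b = ∑ i, Γ (i, b) (i, a) := by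
  simp only [krausDualOne, Matrix.sum_apply, Matrix.smul_apply, conjTranspose_single, star_one]
  refine Finset.sum_congr rfl fun i _ => ?_
  rw [Finset.sum_eq_single b (by
    intro j _ hj
    simp [single_apply, hj, Matrix.mul_apply]) (by simp)]
  rw [Finset.sum_eq_single i (by
    intro j _ hj
    simp [hj]) (by simp)]
  simp [single_apply]

theorem lindblad_sum_eq (Γ : Matrix (Fin N × Fin N) (Fin N × Fin N) ℂ) (ρ : Mat N) :
    (1 / 2 : ℂ) • ∑ i, ∑ j, ∑ k, ∑ l,
        Γ (i, j) (k, l) • (⁅stdE i j, ρ * (stdE k l)ᴴ⁆ + ⁅stdE i j * ρ, (stdE k l)ᴴ⁆) =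
      krausMap Γ ρ - (1 / 2 : ℂ) • (krausDualOne Γ * ρ + ρ * krausDualOne Γ) := by
  have h : ∑ i, ∑ j, ∑ k, ∑ l,
        Γ (i, j) (k, l) • (⁅stdE i j, ρ * (stdE k l)ᴴ⁆ + ⁅stdE i j * ρ, (stdE k l)ᴴ⁆) =
      (2 : ℂ) • krausMap Γ ρ - (krausDualOne Γ * ρ + ρ * krausDualOne Γ) := by
    simp only [krausMap, krausDualOne, Finset.sum_mul, Finset.mul_sum, Finset.smul_sum,
      ← Finset.sum_add_distrib, ← Finset.sum_sub_distrib]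
    refine Finset.sum_congr rfl fun i _ => Finset.sum_congr rfl fun j _ =>
      Finset.sum_congr rfl fun k _ => Finset.sum_congr rfl fun l _ => ?_
    simp only [Ring.lie_def, Matrix.mul_assoc, smul_mul_assoc, mul_smul_comm, smul_add, smul_sub,
      two_smul]
    abel
  rw [h, smul_sub, smul_smul]
  norm_num

/-! ### Choi matrices and complete positivity -/

/-- The coefficients of a linear map in the expansion `φ(ρ) = ∑ c_{ijkl} E_{ij} ρ E_{kl}^*`. -/
def choi (φ : Mat N →ₗ[ℂ] Mat N) : Matrix (Fin N × Fin N) (Fin N × Fin N) ℂ :=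
  of fun p q => φ (stdE p.2 q.2) p.1 q.1

theorem krausMap_choi (φ : Mat N →ₗ[ℂ] Mat N) (ρ : Mat N) : krausMap (choi φ) ρ = φ ρ := by
  ext a b
  conv_rhs => rw [matrix_eq_sum_single ρ]
  rw [krausMap_apply]
  simp only [map_sum, Matrix.sum_apply, choi, of_apply]
  refine Finset.sum_congr rfl fun j _ => Finset.sum_congr rfl fun l _ => ?_
  have : single j l (ρ j l) = ρ j l • stdE j l := by simp [smul_single]
  rw [this, map_smul, Matrix.smul_apply, smul_eq_mul, mul_comm]

/-- The coordinates of the identity matrix in the standard basis. -/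
def vecOne (N : ℕ) : Fin N × Fin N → ℂ := fun p => (1 : Mat N) p.1 p.2

theorem star_vecOne : star (vecOne N) = vecOne N := by
  ext p
  simp [vecOne, one_apply, apply_ite]

theorem vecOne_dotProduct_vecOne : vecOne N ⬝ᵥ vecOne N = N := by
  simp [dotProduct, vecOne, Fintype.sum_prod_type, one_apply]

theorem choi_id : choi (LinearMap.id : Mat N →ₗ[ℂ] Mat N) = vecMulVec (vecOne N) (vecOne N) := by
  ext ⟨i, j⟩ ⟨k, l⟩
  simp only [choi, vecMulVec_apply, vecOne, of_apply, LinearMap.id_apply, one_apply, single_apply]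
  by_cases h : i = j <;> by_cases h' : k = l <;> simp [h, h', eq_comm]

theorem IsCompletelyPositive.choi_posSemidef {φ : Mat N →ₗ[ℂ] Mat N}
    (h : IsCompletelyPositive φ) : (choi φ).PosSemidef := by
  have h1 := h N (of fun j l => stdE j l) (by
    convert posSemidef_vecMulVec_self_star (vecOne N) using 1
    ext ⟨i, j⟩ ⟨k, l⟩
    simp only [star_vecOne, vecMulVec_apply, comp_apply, vecOne, of_apply, one_apply, single_apply]
    by_cases h : i = j <;> by_cases h' : k = l <;> simp [h, h'])
  -- `Matrix.comp` puts the block index first; `choi` puts it second.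
  exact h1.submatrix Prod.swap

/-- The orthogonal projection onto the coordinates of the traceless matrices. -/
noncomputable def tracelessProj (N : ℕ) : Matrix (Fin N × Fin N) (Fin N × Fin N) ℂ :=
  1 - (N : ℂ)⁻¹ • vecMulVec (vecOne N) (vecOne N)

theorem tracelessProj_isHermitian : (tracelessProj N).IsHermitian := by
  have : (vecMulVec (vecOne N) (vecOne N)).IsHermitian := by
    rw [IsHermitian, conjTranspose_vecMulVec, star_vecOne]
  simp [tracelessProj, IsHermitian, conjTranspose_sub, conjTranspose_smul, this.eq]

theorem tracelessProj_mulVec_vecOne (hN : N ≠ 0) : tracelessProj N *ᵥ vecOne N = 0 := by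
  have : (N : ℂ) ≠ 0 := by exact_mod_cast hN
  rw [tracelessProj, sub_mulVec, one_mulVec, smul_mulVec, vecMulVec_mulVec,
    vecOne_dotProduct_vecOne]
  ext p
  simp [mul_comm (vecOne N p), this]

theorem vecOne_vecMul_tracelessProj (hN : N ≠ 0) : vecOne N ᵥ* tracelessProj N = 0 := by
  have h := congrArg star (tracelessProj_mulVec_vecOne hN)
  rwa [star_mulVec, tracelessProj_isHermitian.eq, star_vecOne, star_zero] at h

theorem posSemidef_of_tendsto {n ι : Type*} [Fintype n] {l : Filter ι} [l.NeBot]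
    {f : ι → Matrix n n ℂ} {M : Matrix n n ℂ} (hf : Tendsto f l (𝓝 M))
    (hpos : ∀ᶠ x in l, (f x).PosSemidef) : M.PosSemidef := by
  refine .of_dotProduct_mulVec_nonneg ?_ fun x => ?_
  · have h1 : Tendsto (fun t => (f t)ᴴ) l (𝓝 Mᴴ) :=
      (continuous_id.matrix_conjTranspose.tendsto M).comp hf
    exact tendsto_nhds_unique (h1.congr' (hpos.mono fun t ht => ht.isHermitian.eq)) hf
  · have hc : Continuous fun A : Matrix n n ℂ => star x ⬝ᵥ (A *ᵥ x) :=
      continuous_const.dotProduct (continuous_id.matrix_mulVec continuous_const)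
    exact ge_of_tendsto ((hc.tendsto M).comp hf)
      (hpos.mono fun t ht => ht.dotProduct_mulVec_nonneg x)

theorem tendsto_choi {L : Mat N →ₗ[ℂ] Mat N} {T : ℝ≥0 → (Mat N →ₗ[ℂ] Mat N)}
    (h : ∀ A : Mat N,
      Tendsto (fun t : ℝ≥0 => ((t : ℝ)⁻¹ : ℂ) • (T t A - A)) (𝓝[>] 0) (𝓝 (L A))) :
    Tendsto (fun t : ℝ≥0 => ((t : ℝ)⁻¹ : ℂ) • (choi (T t) - choi LinearMap.id)) (𝓝[>] 0)
      (𝓝 (choi L)) := by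
  refine tendsto_pi_nhds.2 fun p => tendsto_pi_nhds.2 fun q => ?_
  exact tendsto_pi_nhds.1 (tendsto_pi_nhds.1 (h (stdE p.2 q.2)) p.1) q.1

/-- The compression kills `choi id`, the only negative term in the difference quotient, so it is a
limit of positive semidefinite matrices. -/
theorem posSemidef_compress_choi (hN : N ≠ 0) {L : Mat N →ₗ[ℂ] Mat N} (hL : IsQDSGenerator L) :
    (tracelessProj N * choi L * tracelessProj N).PosSemidef := by
  obtain ⟨T, hT, hlim⟩ := hL
  have hc : Continuous fun A : Matrix (Fin N × Fin N) (Fin N × Fin N) ℂ =>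
      tracelessProj N * A * tracelessProj N := by fun_prop
  refine posSemidef_of_tendsto ((hc.tendsto _).comp (tendsto_choi hlim)) (.of_forall fun t => ?_)
  have h0 : tracelessProj N * choi LinearMap.id * tracelessProj N = 0 := by
    rw [choi_id, mul_vecMulVec, tracelessProj_mulVec_vecOne hN, zero_vecMulVec, Matrix.zero_mul]
  have h1 := ((hT.completelyPositive t).choi_posSemidef.mul_mul_conjTranspose_same
    (tracelessProj N)).smul (a := ((t : ℝ)⁻¹ : ℂ)) (by
      rw [← Complex.ofReal_inv]
      exact_mod_cast inv_nonneg.2 t.2)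
  rw [tracelessProj_isHermitian.eq] at h1
  simpa [mul_sub, sub_mul, h0] using h1

theorem isHermitian_choi {L : Mat N →ₗ[ℂ] Mat N} (hL : IsQDSGenerator L) :
    (choi L).IsHermitian := by
  obtain ⟨T, hT, hlim⟩ := hL
  have h := tendsto_choi hlim
  refine tendsto_nhds_unique (((continuous_id.matrix_conjTranspose.tendsto _).comp h).congr
    fun t => ?_) h
  have h1 := (hT.completelyPositive t).choi_posSemidef.isHermitian.eq
  have h2 : (choi (LinearMap.id : Mat N →ₗ[ℂ] Mat N))ᴴ = choi LinearMap.id := by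
    rw [choi_id, conjTranspose_vecMulVec, star_vecOne]
  simp [conjTranspose_sub, conjTranspose_smul, h1, h2]

theorem trace_generator {L : Mat N →ₗ[ℂ] Mat N} (hL : IsQDSGenerator L) (A : Mat N) :
    (L A).trace = 0 := by
  obtain ⟨T, hT, hlim⟩ := hL
  have hc : Continuous fun A : Mat N => A.trace := continuous_id.matrix_trace
  refine tendsto_nhds_unique ((hc.tendsto _).comp (hlim A)) (tendsto_const_nhds.congr fun t => ?_)
  simp [trace_sub, hT.trace]

/-! ### Existence of the canonical form -/

theorem krausMap_add (Γ Δ : Matrix (Fin N × Fin N) (Fin N × Fin N) ℂ) (ρ : Mat N) :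
    krausMap (Γ + Δ) ρ = krausMap Γ ρ + krausMap Δ ρ := by
  ext a b
  simp [krausMap_apply, add_mul, Finset.sum_add_distrib]

theorem krausMap_vecMulVec_vecOne_right (u : Fin N × Fin N → ℂ) (ρ : Mat N) :
    krausMap (vecMulVec u (vecOne N)) ρ = of (fun i j => u (i, j)) * ρ := by
  ext a b
  simp [krausMap_apply, vecMulVec_apply, vecOne, one_apply, Matrix.mul_apply]

theorem krausMap_vecMulVec_vecOne_left (u : Fin N × Fin N → ℂ) (ρ : Mat N) :
    krausMap (vecMulVec (vecOne N) (star u)) ρ = ρ * (of (fun i j => u (i, j)))ᴴ := by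
  ext a b
  simp only [krausMap_apply, vecMulVec_apply, vecOne, one_apply, Matrix.mul_apply]
  rw [Finset.sum_eq_single a (by
    intro i _ hi
    simp [Ne.symm hi]) (by simp)]
  simp [mul_comm]

theorem compress_decomposition {c : Matrix (Fin N × Fin N) (Fin N × Fin N) ℂ}
    (hc : c.IsHermitian) :
    ∃ u : Fin N × Fin N → ℂ, c = tracelessProj N * c * tracelessProj N +
      (vecMulVec u (vecOne N) + vecMulVec (vecOne N) (star u)) := by
  have hω := star_vecOne (N := N)
  rw [tracelessProj]
  generalize vecOne N = ω at hω ⊢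
  have h1 : ω ᵥ* c = star (c *ᵥ ω) := by rw [star_mulVec, hc.eq, hω]
  have hs : star (ω ⬝ᵥ (c *ᵥ ω)) = ω ⬝ᵥ (c *ᵥ ω) := by
    have := star_dotProduct (c *ᵥ ω) ω
    rwa [hω, ← h1, ← dotProduct_mulVec, eq_comm] at this
  have hs' : star (c *ᵥ ω) ⬝ᵥ ω = ω ⬝ᵥ (c *ᵥ ω) := by rw [← h1, ← dotProduct_mulVec]
  -- The `ω ωᵀ` term of `c - QcQ`, with `Q` the projection, has a real coefficient and is shared
  -- equally between `u` and `star u`; hence the factor `1/2`.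
  refine ⟨(N : ℂ)⁻¹ • (c *ᵥ ω) - ((2 : ℂ)⁻¹ * (N : ℂ)⁻¹ ^ 2 * (ω ⬝ᵥ (c *ᵥ ω))) • ω, ?_⟩
  ext p q
  simp only [sub_mul, mul_sub, one_mul, mul_one, smul_mul_assoc, mul_smul_comm,
    mul_vecMulVec, vecMulVec_mul, vecMulVec_mulVec, h1, hs', Matrix.sub_apply, Matrix.add_apply,
    Matrix.smul_apply, vecMulVec_apply, Pi.sub_apply, Pi.smul_apply, Pi.star_apply, star_sub,
    star_smul, star_mul, star_pow, hs, hω, smul_eq_mul, MulOpposite.smul_eq_mul_unop,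
    MulOpposite.unop_op]
  simp only [star_inv₀, star_natCast, star_ofNat]
  ring

theorem trace_krausMap (Γ : Matrix (Fin N × Fin N) (Fin N × Fin N) ℂ) (ρ : Mat N) :
    (krausMap Γ ρ).trace = (krausDualOne Γ * ρ).trace := by
  simp only [krausMap, krausDualOne, Finset.sum_mul, trace_sum, smul_mul_assoc, trace_smul]
  refine Finset.sum_congr rfl fun i _ => Finset.sum_congr rfl fun j _ =>
      Finset.sum_congr rfl fun k _ => Finset.sum_congr rfl fun l _ => ?_
  rw [trace_mul_comm, Matrix.mul_assoc]

theorem coeffOperator_apply (Γ : Matrix (Fin N × Fin N) (Fin N × Fin N) ℂ) (A : Mat N)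
    (i j : Fin N) :
    coeffOperator Γ A i j = (Γ *ᵥ fun p => A p.1 p.2) (i, j) := by
  rw [coeffOperator, mulVec, dotProduct, Fintype.sum_prod_type, Matrix.sum_apply,
    Finset.sum_eq_single i (by
      intro a _ ha
      simp [Matrix.sum_apply, ha]) (by simp), Matrix.sum_apply,
    Finset.sum_eq_single j (by
      intro a _ ha
      simp [ha]) (by simp)]
  simp

theorem trace_coeffOperator (Γ : Matrix (Fin N × Fin N) (Fin N × Fin N) ℂ) (A : Mat N) :
    (coeffOperator Γ A).trace = (vecOne N ᵥ* Γ) ⬝ᵥ fun p => A p.1 p.2 := by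
  rw [← dotProduct_mulVec]
  simp [trace, coeffOperator_apply, dotProduct, Fintype.sum_prod_type, vecOne, one_apply]

/-- Existence in the Gorini-Kossakowski-Sudarshan-Lindblad theorem. -/
theorem exists_isCanonicalForm (hN : N ≠ 0) {L : Mat N →ₗ[ℂ] Mat N} (hL : IsQDSGenerator L) :
    ∃ H Γ, IsCanonicalForm L H Γ := by
  have hN' : (N : ℂ) ≠ 0 := by exact_mod_cast hN
  obtain ⟨u, hu⟩ := compress_decomposition (isHermitian_choi hL)
  set Γ := tracelessProj N * choi L * tracelessProj N with hΓ
  set K : Mat N := of fun i j => u (i, j)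
  have hLρ (ρ : Mat N) : L ρ = krausMap Γ ρ + (K * ρ + ρ * Kᴴ) := by
    rw [← krausMap_choi L, hu, krausMap_add, krausMap_add, krausMap_vecMulVec_vecOne_right,
      krausMap_vecMulVec_vecOne_left]
  -- `Tr (L ρ) = 0` for every `ρ`, and the trace pairing is nondegenerate.
  have hM : krausDualOne Γ = -(K + Kᴴ) := by
    rw [eq_neg_iff_add_eq_zero]
    refine ext_iff_trace_mul_right.2 fun ρ => ?_
    have := trace_generator hL ρ
    rw [hLρ, trace_add, trace_krausMap, trace_add, trace_mul_comm ρ] at this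
    simpa [add_mul, trace_add] using this
  -- Chosen so that `K = (K + Kᴴ) / 2 - i G`; subtracting a scalar later makes it traceless without
  -- changing the commutator.
  set G : Mat N := (Complex.I / 2) • (K - Kᴴ) with hG
  have hGh : Gᴴ = G := by
    rw [hG, conjTranspose_smul, conjTranspose_sub, conjTranspose_conjTranspose, ← neg_sub K,
      smul_neg, ← neg_smul]
    congr 1
    simp [neg_div]
  refine ⟨G - (G.trace / N) • (1 : Mat N), Γ, ?_, ?_, posSemidef_compress_choi hN hL, ?_, ?_, ?_⟩
  · have : star G.trace = G.trace := by rw [← trace_conjTranspose, hGh]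
    rw [IsHermitian, conjTranspose_sub, hGh, conjTranspose_smul, conjTranspose_one, star_div₀, this]
    simp
  · simp [trace_sub, hN']
  · ext i j
    rw [coeffOperator_apply, hΓ, ← mulVec_mulVec]
    have : (fun p : Fin N × Fin N => (1 : Mat N) p.1 p.2) = vecOne N := rfl
    rw [this, tracelessProj_mulVec_vecOne hN]
    simp
  · intro A
    rw [trace_coeffOperator, hΓ, Matrix.mul_assoc, ← vecMul_vecMul, vecOne_vecMul_tracelessProj hN]
    simp
  · intro ρ
    rw [lindblad_sum_eq, hLρ, hM, hG, Ring.lie_def]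
    have hI : Complex.I * (Complex.I / 2) = -(1 / 2) := by
      rw [← mul_div_assoc, Complex.I_mul_I]; ring
    simp only [sub_mul, mul_sub, smul_mul_assoc, mul_smul_comm, one_mul, mul_one, smul_sub, neg_mul,
      mul_neg, add_mul, mul_add, smul_add, smul_neg, neg_smul, smul_smul, hI]
    module

theorem isCanonicalForm_canonicalPair (hN : N ≠ 0) {L : Mat N →ₗ[ℂ] Mat N}
    (hL : IsQDSGenerator L) : IsCanonicalForm L (hamiltonian L) (coeffMatrix L) := by
  obtain ⟨H, Γ, h⟩ := exists_isCanonicalForm hN hL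
  exact Classical.epsilon_spec
    (p := fun p : Mat N × Matrix (Fin N × Fin N) (Fin N × Fin N) ℂ => IsCanonicalForm L p.1 p.2)
    ⟨(H, Γ), h⟩

/-! ### Components of the graph and the trace -/

theorem PosSemidef.apply_eq_zero_of_diag {n : Type*} [Fintype n] [DecidableEq n]
    {M : Matrix n n ℂ} (hM : M.PosSemidef) {q : n} (h : M q q = 0) (p : n) : M p q = 0 := by
  have h1 := (hM.dotProduct_mulVec_zero_iff (Pi.single q 1)).1 (by simp [h])
  simpa using congrFun h1 p

theorem connectedComponentMk_eq_of_coeffMatrix_ne_zero {L : Mat N →ₗ[ℂ] Mat N}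
    (hpos : (coeffMatrix L).PosSemidef) {i j : Fin N} (h : coeffMatrix L (i, j) (i, j) ≠ 0) :
    (inducedGraph L).connectedComponentMk i = (inducedGraph L).connectedComponentMk j := by
  by_cases hij : i = j
  · rw [hij]
  have hw : 0 < weight L i j :=
    (Complex.pos_iff.1 ((hpos.diag_nonneg (i := (i, j))).lt_of_ne h.symm)).1
  refine SimpleGraph.ConnectedComponent.sound (SimpleGraph.Adj.reachable ?_)
  exact ⟨hij, Or.inr ⟨hij, hw⟩⟩

open Classical in
theorem blockProj_eq_diagonal {G : SimpleGraph (Fin N)} (c : G.ConnectedComponent) :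
    blockProj c = diagonal fun i => if G.connectedComponentMk i = c then 1 else 0 := by
  rw [blockProj, ← sum_single_eq_diagonal]
  refine Finset.sum_congr rfl fun i _ => ?_
  by_cases h : G.connectedComponentMk i = c <;> simp [h]

/-- The hypothesis kills one off-diagonal block of `H`; hermiticity kills the other. -/
theorem blockProj_commute {G : SimpleGraph (Fin N)} {H : Mat N} (hH : H.IsHermitian)
    (k : G.ConnectedComponent)
    (h : ∀ l : G.ConnectedComponent, l ≠ k → blockProj k * H * blockProj l = 0) :
    blockProj k * H = H * blockProj k := by
  classical
  have key (a b : Fin N) (ha : G.connectedComponentMk a = k) (hb : G.connectedComponentMk b ≠ k) :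
      H a b = 0 := by
    have := congrFun (congrFun (h _ hb) a) b
    simpa [blockProj_eq_diagonal, ha] using this
  ext a b
  simp only [blockProj_eq_diagonal, diagonal_mul, mul_diagonal]
  by_cases ha : G.connectedComponentMk a = k <;> by_cases hb : G.connectedComponentMk b = k
  · simp [ha, hb]
  · simp [ha, hb, key a b ha hb]
  · simp [ha, hb, ← hH.apply a b, key b a hb ha]
  · simp [ha, hb]

theorem trace_diagonal_mul_dissipator (Γ : Matrix (Fin N × Fin N) (Fin N × Fin N) ℂ)
    (p : Fin N → ℂ) (h : ∀ i j l, Γ (i, j) (i, l) ≠ 0 → p i = p j ∧ p i = p l) (A : Mat N) :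
    (diagonal p * (krausMap Γ A -
      (1 / 2 : ℂ) • (krausDualOne Γ * A + A * krausDualOne Γ))).trace = 0 := by
  have h1 : ∑ a, p a * krausMap Γ A a a = ∑ j, ∑ l, ∑ i, p i * (Γ (i, j) (i, l) * A j l) := by
    simp only [krausMap_apply, Finset.mul_sum]
    rw [Finset.sum_comm]
    exact Finset.sum_congr rfl fun j _ => Finset.sum_comm
  have h2 : ∑ a, p a * (krausDualOne Γ * A) a a =
      ∑ j, ∑ l, ∑ i, p l * (Γ (i, j) (i, l) * A j l) := by
    simp only [Matrix.mul_apply, krausDualOne_apply, Finset.mul_sum, Finset.sum_mul]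
    rw [Finset.sum_comm]
  have h3 : ∑ a, p a * (A * krausDualOne Γ) a a =
      ∑ j, ∑ l, ∑ i, p j * (Γ (i, j) (i, l) * A j l) := by
    simp only [Matrix.mul_apply, krausDualOne_apply, Finset.mul_sum]
    simp only [mul_comm (A _ _)]
  have h4 : (diagonal p * (krausMap Γ A -
      (1 / 2 : ℂ) • (krausDualOne Γ * A + A * krausDualOne Γ))).trace =
      ∑ a, p a * krausMap Γ A a a - (1 / 2) * (∑ a, p a * (krausDualOne Γ * A) a a +
        ∑ a, p a * (A * krausDualOne Γ) a a) := by
    simp only [trace, diag_apply, diagonal_mul, Matrix.sub_apply, Matrix.smul_apply, Matrix.add_apply, smul_eq_mul,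
      Finset.mul_sum, ← Finset.sum_add_distrib, ← Finset.sum_sub_distrib]
    exact Finset.sum_congr rfl fun a _ => by ring
  rw [h4, h1, h2, h3]
  simp only [Finset.mul_sum, ← Finset.sum_add_distrib, ← Finset.sum_sub_distrib]
  refine Finset.sum_eq_zero fun j _ => Finset.sum_eq_zero fun l _ => Finset.sum_eq_zero fun i _ => ?_
  by_cases hΓ : Γ (i, j) (i, l) = 0
  · simp [hΓ]
  · obtain ⟨hj, hl⟩ := h i j l hΓ
    rw [← hj, ← hl]
    ring

end QDS

theorem mainTheorem10 {N : ℕ} (L : QDS.Mat N →ₗ[ℂ] QDS.Mat N) (hL : QDS.IsQDSGenerator L)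
    (k : (QDS.inducedGraph L).ConnectedComponent)
    (hH : ∀ l : (QDS.inducedGraph L).ConnectedComponent, l ≠ k →
      QDS.blockProj k * QDS.hamiltonian L * QDS.blockProj l = 0)
    (A : QDS.Mat N) :
    (QDS.blockProj k * L A).trace = 0 := by
  classical
  -- The projection onto traceless matrices divides by `N`.
  rcases eq_or_ne N 0 with rfl | hN
  · simp [Matrix.trace]
  have hc := QDS.isCanonicalForm_canonicalPair hN hL
  rw [hc.form, QDS.lindblad_sum_eq, mul_add, Matrix.trace_add]
  have h1 : (QDS.blockProj k * (-Complex.I • ⁅QDS.hamiltonian L, A⁆)).trace = 0 := by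
    rw [mul_smul_comm, Matrix.trace_smul, Ring.lie_def, mul_sub, Matrix.trace_sub,
      ← Matrix.mul_assoc, QDS.blockProj_commute hc.hermitian k hH, Matrix.mul_assoc,
      Matrix.trace_mul_comm, Matrix.mul_assoc, sub_self, smul_zero]
  rw [h1, zero_add, QDS.blockProj_eq_diagonal]
  refine QDS.trace_diagonal_mul_dissipator _ _ (fun i j l h => ?_) A
  have hl : QDS.coeffMatrix L (i, l) (i, l) ≠ 0 := fun h0 =>
    h (QDS.PosSemidef.apply_eq_zero_of_diag hc.posSemidef h0 _)
  have hj : QDS.coeffMatrix L (i, j) (i, j) ≠ 0 := fun h0 => h (by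
    rw [← hc.posSemidef.isHermitian.apply,
      QDS.PosSemidef.apply_eq_zero_of_diag hc.posSemidef h0, star_zero])
  rw [QDS.connectedComponentMk_eq_of_coeffMatrix_ne_zero hc.posSemidef hj] 
  refine ⟨rfl, ?_⟩
  rw [← QDS.connectedComponentMk_eq_of_coeffMatrix_ne_zero hc.posSemidef hj,
    QDS.connectedComponentMk_eq_of_coeffMatrix_ne_zero hc.posSemidef hl]
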